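/- Let $k$ be a field of characteristic $0$. A representation is a pair $(L,V)$ of a Lie algebra $L$ over $k$ and an $L$-module $V$, regarded as a two-sorted algebra (elements of $L$ are of sort $1$, elements of $V$ of sort $2$); a homomorphism $(L,V)\to(L',V')$ is a pair of a Lie algebra homomorphism and a linear map compatible with the actions. Fix countably infinite disjoint sets $X_0^{(1)},X_0^{(2)}$ of variables of sorts $1$ and $2$. For finite sets $X^{(i)}\subset X_0^{(i)}$ and $X=X^{(1)}\cup X^{(2)}$, the absolutely free representation $F(X)$ consists of the free Lie algebra $L(X^{(1)})$ and the free left module $A(X^{(1)})X^{(2)}$ with basis $X^{(2)}$ over the free associative unital algebra $A(X^{(1)})$, on which $L(X^{(1)})$ acts through the canonical map $L(X^{(1)})\to A(X^{(1)})$. Let $\Theta$ be a variety of representations, i.e. the class of all representations satisfying a given set of identities. Put $F_\Theta(X)=\bigl(L(X^{(1)})/I_\Theta(X^{(1)}),\ A(X^{(1)})X^{(2)}/V_\Theta(X)\bigr)$, where $I_\Theta(X^{(1)})$ and $V_\Theta(X)$ consist of those $w$ of sort $1$, respectively $2$, for which $w=0$ is an identity of $\Theta$. Let $\Theta^0$ be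 the category whose objects are the free representations $F_\Theta(X)$, one for each finite $X\subset X_0^{(1)}\cup X_0^{(2)}$, and whose morphisms are all homomorphisms. Suppose that $\Theta$ is of action type, i.e. $I_\Theta(X^{(1)})=\{0\}$ for every finite $X^{(1)}\subset X_0^{(1)}$, and nontrivial, i.e. the identity $x^{(2)}=0$ is not fulfilled in $\Theta$. Then for every automorphism $\Phi$ of the category $\Theta^0$ and all variables $x^{(1)}\in X_0^{(1)}$, $x^{(2)}\in X_0^{(2)}$, $$\Phi\bigl(F_\Theta(x^{(1)})\bigr)\cong F_\Theta(x^{(1)})\quad\text{and}\quad \Phi\bigl(F_\Theta(x^{(2)})\bigr)\cong F_\Theta(x^{(2)}).$$ In particular $\Phi$ cannot swap these two objects, even up to isomorphism: $\Phi(F_\Theta(x^{(1)}))\not\cong F_\Theta(x^{(2)})$ and $\Phi(F_\Theta(x^{(2)}))\not\cong F_\Theta(x^{(1)})$. -/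

import Mathlib

open CategoryTheory

universe u

/-- A representation of a Lie algebra over `k`, as a two-sorted algebra: `L` is the Lie algebra
(first sort), `V` is the vector space (second sort), and the action `l ∘ v` is `⁅l, v⁆`. -/
structure LieRepr (k : Type u) [Field k] : Type (u + 1) where
  L : Type u
  V : Type u
  [lieRing : LieRing L]
  [lieAlgebra : LieAlgebra k L]
  [addCommGroup : AddCommGroup V]
  [module : Module k V]
  [lieRingModule : LieRingModule L V]
  [lieModule : LieModule k L V]

namespace LieRepr

attribute [instance] lieRing lieAlgebra addCommGroup module lieRingModule lieModule

variable {k : Type u} [Field k]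

/-- A homomorphism of two-sorted algebras: a homomorphism of Lie algebras and a linear map which
together respect the action. -/
@[ext]
structure Hom (H K : LieRepr k) where
  onL : H.L →ₗ⁅k⁆ K.L
  onV : H.V →ₗ[k] K.V
  map_act : ∀ (l : H.L) (v : H.V), onV ⁅l, v⁆ = ⁅onL l, onV v⁆

instance : Category (LieRepr k) where
  Hom H K := Hom H K
  id H := { onL := LieHom.id, onV := LinearMap.id, map_act := fun _ _ => rfl }
  comp f g :=
    { onL := g.onL.comp f.onL
      onV := g.onV.comp f.onV
      map_act := fun l v => by simp [f.map_act, g.map_act] }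

end LieRepr

section FreeRepresentation

variable (k : Type u) [Field k] (X₁ X₂ : Type)

attribute [local instance 100] LieRing.ofAssociativeRing

/-- The canonical homomorphism `ι : L(X₁) → A(X₁)` from the free Lie algebra to the free
associative algebra with unit, identical on the generators. -/
noncomputable def freeLieToAssoc : FreeLieAlgebra k X₁ →ₗ⁅k⁆ FreeAlgebra k X₁ :=
  FreeLieAlgebra.lift k (FreeAlgebra.ι k)

/-- The free left `A(X₁)`-module `A(X₁) X₂` with basis `X₂`. -/
abbrev FreeVec : Type u := X₂ →₀ FreeAlgebra k X₁

/-- `L(X₁)` acts on `A(X₁) X₂` by `l ∘ v = ι(l) v`. -/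
noncomputable instance FreeVec.instLieRingModule :
    LieRingModule (FreeLieAlgebra k X₁) (FreeVec k X₁ X₂) where
  bracket l v := freeLieToAssoc k X₁ l • v
  add_lie l m v := by
    change freeLieToAssoc k X₁ (l + m) • v = _ • v + _ • v
    rw [map_add, add_smul]
  lie_add l v w := smul_add _ v w
  leibniz_lie l m v := by
    change freeLieToAssoc k X₁ l • freeLieToAssoc k X₁ m • v
      = freeLieToAssoc k X₁ ⁅l, m⁆ • v + freeLieToAssoc k X₁ m • freeLieToAssoc k X₁ l • v
    rw [LieHom.map_lie, LieRing.of_associative_ring_bracket, sub_smul, mul_smul, mul_smul,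
      sub_add_cancel]

instance FreeVec.instLieModule : LieModule k (FreeLieAlgebra k X₁) (FreeVec k X₁ X₂) where
  smul_lie t l v := by
    change freeLieToAssoc k X₁ (t • l) • v = t • freeLieToAssoc k X₁ l • v
    rw [map_smul, smul_assoc]
  lie_smul t l v := by
    change freeLieToAssoc k X₁ l • t • v = t • freeLieToAssoc k X₁ l • v
    rw [smul_comm]

/-- The absolutely free representation `F(X)` generated by `X = X₁ ∪ X₂`. -/
noncomputable abbrev freeRepr : LieRepr k where
  L := FreeLieAlgebra k X₁
  V := FreeVec k X₁ X₂

end FreeRepresentation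

section Identities

variable {k : Type u} [Field k] {X₁ X₂ : Type}

/-- The identity `l = 0` (of the first sort, in the variables `X₁`) is fulfilled in `H`. -/
def HoldsL (H : LieRepr k) (l : FreeLieAlgebra k X₁) : Prop :=
  ∀ φ : FreeLieAlgebra k X₁ →ₗ⁅k⁆ H.L, φ l = 0

/-- The identity `v = 0` (of the second sort, in the variables `X₁ ∪ X₂`) is fulfilled in `H`. -/
def HoldsV (H : LieRepr k) (v : FreeVec k X₁ X₂) : Prop :=
  ∀ μ : freeRepr k X₁ X₂ ⟶ H, μ.onV v = 0

/-- `Θ` is a variety of representations: the class of all representations in which all the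
identities from some set are fulfilled. The variables of either sort are indexed by `ℕ`, and since
both sorts are abelian groups every identity can be written with right-hand side zero. -/
def IsVariety (Θ : Set (LieRepr k)) : Prop :=
  ∃ (E₁ : Set (FreeLieAlgebra k ℕ)) (E₂ : Set (FreeVec k ℕ ℕ)),
    ∀ H : LieRepr k, H ∈ Θ ↔ (∀ l ∈ E₁, HoldsL H l) ∧ (∀ v ∈ E₂, HoldsV H v)

variable (Θ : Set (LieRepr k)) (X₁ X₂)

/-- The ideal `I_Θ(X₁)` of `L(X₁)`: all the identities `l = 0` of `Θ` in the variables `X₁`. -/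
def identIdeal : LieIdeal k (FreeLieAlgebra k X₁) where
  carrier := {l | ∀ H ∈ Θ, HoldsL H l}
  zero_mem' _ _ φ := map_zero φ
  add_mem' ha hb H hH φ := by rw [map_add, ha H hH φ, hb H hH φ, add_zero]
  smul_mem' t _ ha H hH φ := by rw [map_smul, ha H hH φ, smul_zero]
  lie_mem ha H hH φ := by rw [LieHom.map_lie, ha H hH φ, lie_zero]

/-- The submodule `V_Θ(X)` of `A(X₁) X₂`: all the identities `v = 0` of `Θ` in the variables
`X = X₁ ∪ X₂`. -/
def identSubmodule : LieSubmodule k (FreeLieAlgebra k X₁) (FreeVec k X₁ X₂) where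
  carrier := {v | ∀ H ∈ Θ, HoldsV H v}
  zero_mem' _ _ μ := map_zero μ.onV
  add_mem' {a b} ha hb H hH μ :=
    (map_add μ.onV a b).trans ((congrArg₂ (· + ·) (ha H hH μ) (hb H hH μ)).trans (add_zero 0))
  smul_mem' t a ha H hH μ :=
    (map_smul μ.onV t a).trans ((congrArg (t • ·) (ha H hH μ)).trans (smul_zero t))
  lie_mem {l a} ha H hH μ :=
    (μ.map_act l a).trans ((congrArg (⁅μ.onL l, ·⁆) (ha H hH μ)).trans (lie_zero _))

theorem lie_mem_identSubmodule {l : FreeLieAlgebra k X₁} (hl : l ∈ identIdeal X₁ Θ)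
    (v : FreeVec k X₁ X₂) : ⁅l, v⁆ ∈ identSubmodule X₁ X₂ Θ := by
  intro H hH μ
  have h := μ.map_act l v
  rw [show μ.onL l = 0 from hl H hH μ.onL, zero_lie] at h
  exact h

/-- The action of `L(X₁)` on `A(X₁) X₂ / V_Θ(X)`, factored through `L(X₁) / I_Θ(X₁)`. -/
noncomputable def quotAction : (FreeLieAlgebra k X₁ ⧸ identIdeal X₁ Θ) →ₗ[k]
    Module.End k (FreeVec k X₁ X₂ ⧸ identSubmodule X₁ X₂ Θ) :=
  Submodule.liftQ (identIdeal X₁ Θ).toSubmodule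
    (LieModule.toEnd k (FreeLieAlgebra k X₁)
      (FreeVec k X₁ X₂ ⧸ identSubmodule X₁ X₂ Θ) : _ →ₗ[k] _)
    (by
      intro l hl
      ext1 v
      obtain ⟨v, rfl⟩ := LieSubmodule.Quotient.surjective_mk' _ v
      exact (LieSubmodule.Quotient.mk_eq_zero'
        (N := identSubmodule X₁ X₂ Θ)).2 (lie_mem_identSubmodule X₁ X₂ Θ hl v))

noncomputable instance quotLieRingModule : LieRingModule (FreeLieAlgebra k X₁ ⧸ identIdeal X₁ Θ)
    (FreeVec k X₁ X₂ ⧸ identSubmodule X₁ X₂ Θ) where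
  bracket l v := quotAction X₁ X₂ Θ l v
  add_lie l m v := by
    change quotAction X₁ X₂ Θ (l + m) v = _
    rw [map_add]; rfl
  lie_add l v w := map_add _ v w
  leibniz_lie l m v := by
    obtain ⟨l, rfl⟩ := LieSubmodule.Quotient.surjective_mk' _ l
    obtain ⟨m, rfl⟩ := LieSubmodule.Quotient.surjective_mk' _ m
    exact leibniz_lie l m v

instance quotLieModule : LieModule k (FreeLieAlgebra k X₁ ⧸ identIdeal X₁ Θ)
    (FreeVec k X₁ X₂ ⧸ identSubmodule X₁ X₂ Θ) where
  smul_lie t l v := by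
    change quotAction X₁ X₂ Θ (t • l) v = _
    rw [map_smul]; rfl
  lie_smul t l v := map_smul _ t v

/-- The free representation `F_Θ(X) = F(X) / Id_Θ(X)` of `Θ` generated by `X = X₁ ∪ X₂`. -/
noncomputable abbrev relFreeRepr : LieRepr k where
  L := FreeLieAlgebra k X₁ ⧸ identIdeal X₁ Θ
  V := FreeVec k X₁ X₂ ⧸ identSubmodule X₁ X₂ Θ

end Identities

section Category

variable {k : Type u} [Field k] (Θ : Set (LieRepr k))

/-- The category `Θ⁰`. An object is a pair `X = (X₁, X₂)` of finite sets of variables, standing for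
the free representation `F_Θ(X)`; the morphisms are all homomorphisms `F_Θ(X) → F_Θ(Y)`. -/
abbrev FreeCat : Type :=
  InducedCategory (LieRepr k)
    (fun X : Finset ℕ × Finset ℕ => relFreeRepr (↥X.1) (↥X.2) Θ)

/-- `F_Θ(x)` for the variable `x` of the first sort. -/
def freeOnL (x : ℕ) : FreeCat Θ := (({x}, ∅) : Finset ℕ × Finset ℕ)

/-- `F_Θ(x)` for the variable `x` of the second sort. -/
def freeOnV (x : ℕ) : FreeCat Θ := ((∅, {x}) : Finset ℕ × Finset ℕ)

/-- `Θ` is nontrivial: the identity `x = 0`, for a variable `x` of the second sort, is not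
fulfilled in `Θ`. -/
def IsNontrivialVariety : Prop :=
  ¬ ∀ H ∈ Θ, HoldsV H (Finsupp.single 0 1 : FreeVec k ℕ ℕ)

/-- `Θ` is action-type: `I_Θ(X₁) = 0` for all finite sets `X₁` of variables of the first sort. -/
def IsActionType : Prop :=
  ∀ X₁ : Finset ℕ, identIdeal (↥X₁) Θ = ⊥

end Category

-- The two objects are separated from all others, and then from each other, by properties stated
-- with zero morphisms alone, so every autoequivalence respects them. Up to isomorphism, `F_Θ(x⁽¹⁾)`
-- and `F_Θ(x⁽²⁾)` are exactly the nonzero objects with only the idempotents `0` and `1`: keeping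
-- one free generator and killing the rest is a nonzero idempotent, and it is the identity only if
-- there are no other generators (`iso_of_hasTrivialIdempotents`). Hence the two classes are fixed
-- or swapped. A swap would carry `HasInvisibleMorphism` from the pair (sort 1, sort 2) to the pair
-- (sort 2, sort 1). It holds for the first, because the commutator of two free Lie generators is
-- nonzero but dies in every one-generated free Lie algebra. It fails for the second, because there
-- `T` has no generators of sort 1, and linear coordinates detect every nonzero vector.

attribute [local instance 100] LieRing.ofAssociativeRing

namespace LieRepr

variable {k : Type u} [Field k]

instance : Limits.HasZeroMorphisms (LieRepr k) where
  zero H K := ⟨{ onL := 0, onV := 0, map_act := fun l v => by simp }⟩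
  comp_zero _ _ := rfl
  zero_comp H K M f := Hom.ext (LieHom.ext fun _ => map_zero f.onL)
    (LinearMap.ext fun _ => map_zero f.onV)

end LieRepr

/-! ### Substitutions and small cases in absolutely free representations. -/

section FreeRepresentation

variable {k : Type u} [Field k] {X₁ X₂ Y₁ Y₂ : Type}

@[simp] theorem freeLieToAssoc_of (x : X₁) :
    freeLieToAssoc k X₁ (FreeLieAlgebra.of k x) = FreeAlgebra.ι k x :=
  FreeLieAlgebra.lift_of_apply _ _

theorem FreeVec.lie_def (l : FreeLieAlgebra k X₁) (v : FreeVec k X₁ X₂) :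
    ⁅l, v⁆ = freeLieToAssoc k X₁ l • v := rfl

/-- Multiplication by a generator of `A(X₁)` is the action of the corresponding Lie generator, so
agreement at `w` propagates to all of `A(X₁) w`. -/
theorem freeRepr_hom_ext {H : LieRepr k} {f g : freeRepr k X₁ X₂ ⟶ H}
    (hL : ∀ x, f.onL (FreeLieAlgebra.of k x) = g.onL (FreeLieAlgebra.of k x))
    (hV : ∀ y, f.onV (Finsupp.single y 1 : FreeVec k X₁ X₂)
      = g.onV (Finsupp.single y 1 : FreeVec k X₁ X₂)) : f = g := by
  have key : ∀ (a : FreeAlgebra k X₁) (w : FreeVec k X₁ X₂),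
      f.onV w = g.onV w → f.onV (a • w : FreeVec k X₁ X₂) = g.onV (a • w : FreeVec k X₁ X₂) := by
    intro a
    induction a using FreeAlgebra.induction with
    | grade0 r =>
      intro w hw
      rw [algebraMap_smul]
      exact (map_smul f.onV r w).trans ((congrArg (r • ·) hw).trans (map_smul g.onV r w).symm)
    | grade1 x =>
      intro w hw
      rw [← freeLieToAssoc_of, ← FreeVec.lie_def]
      refine (f.map_act _ w).trans (Eq.trans ?_ (g.map_act _ w).symm)
      rw [hw, hL]
    | mul a b ha hb => intro w hw; rw [mul_smul]; exact ha _ (hb _ hw)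
    | add a b ha hb =>
      intro w hw
      rw [add_smul]
      exact (map_add f.onV _ _).trans
        ((congrArg₂ (· + ·) (ha w hw) (hb w hw)).trans (map_add g.onV _ _).symm)
  refine LieRepr.Hom.ext (FreeLieAlgebra.hom_ext hL) (LinearMap.ext fun v => ?_)
  induction v using Finsupp.induction_linear with
  | zero => exact (map_zero f.onV).trans (map_zero g.onV).symm
  | add v w hv hw =>
    exact (map_add f.onV _ _).trans ((congrArg₂ (· + ·) hv hw).trans (map_add g.onV _ _).symm)
  | single y a =>
    have h := key a _ (hV y)
    rwa [Finsupp.smul_single, smul_eq_mul, mul_one] at h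

/-- The homomorphism of free associative algebras extending a substitution of Lie polynomials. -/
noncomputable def assocSubst (f : X₁ → FreeLieAlgebra k Y₁) :
    FreeAlgebra k X₁ →ₐ[k] FreeAlgebra k Y₁ :=
  FreeAlgebra.lift k fun x => freeLieToAssoc k Y₁ (f x)

theorem assocSubst_freeLieToAssoc (f : X₁ → FreeLieAlgebra k Y₁) (l : FreeLieAlgebra k X₁) :
    assocSubst f (freeLieToAssoc k X₁ l) = freeLieToAssoc k Y₁ (FreeLieAlgebra.lift k f l) := by
  have h : ((assocSubst f : FreeAlgebra k X₁ →ₗ⁅k⁆ FreeAlgebra k Y₁).comp (freeLieToAssoc k X₁))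
      = (freeLieToAssoc k Y₁).comp (FreeLieAlgebra.lift k f) :=
    FreeLieAlgebra.hom_ext fun x => by simp [assocSubst]
  exact congrArg (fun φ : FreeLieAlgebra k X₁ →ₗ⁅k⁆ FreeAlgebra k Y₁ => φ l) h

/-- The linear map of free modules extending a substitution of the variables of both sorts. -/
noncomputable def vecSubst (f : X₁ → FreeLieAlgebra k Y₁) (g : X₂ → FreeVec k Y₁ Y₂) :
    FreeVec k X₁ X₂ →ₗ[k] FreeVec k Y₁ Y₂ :=
  Finsupp.lsum k fun y =>
    (LinearMap.toSpanSingleton (FreeAlgebra k Y₁) (FreeVec k Y₁ Y₂) (g y)).restrictScalars k ∘ₗ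
      (assocSubst f).toLinearMap

theorem vecSubst_single (f : X₁ → FreeLieAlgebra k Y₁) (g : X₂ → FreeVec k Y₁ Y₂) (y : X₂)
    (a : FreeAlgebra k X₁) : vecSubst f g (Finsupp.single y a) = assocSubst f a • g y := by
  simp [vecSubst]

theorem vecSubst_smul (f : X₁ → FreeLieAlgebra k Y₁) (g : X₂ → FreeVec k Y₁ Y₂)
    (a : FreeAlgebra k X₁) (v : FreeVec k X₁ X₂) :
    vecSubst f g (a • v) = assocSubst f a • vecSubst f g v := by
  induction v using Finsupp.induction_linear with
  | zero => simp
  | add v w hv hw => rw [smul_add, map_add, hv, hw, map_add, smul_add]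
  | single y b =>
    rw [Finsupp.smul_single, vecSubst_single, vecSubst_single, smul_eq_mul, map_mul, mul_smul]

/-- The homomorphism of absolutely free representations extending a substitution of variables. -/
noncomputable def freeSubst (f : X₁ → FreeLieAlgebra k Y₁) (g : X₂ → FreeVec k Y₁ Y₂) :
    freeRepr k X₁ X₂ ⟶ freeRepr k Y₁ Y₂ where
  onL := FreeLieAlgebra.lift k f
  onV := vecSubst f g
  map_act l v := by
    change vecSubst f g (freeLieToAssoc k X₁ l • v) = freeLieToAssoc k Y₁ _ • vecSubst f g v
    rw [vecSubst_smul, assocSubst_freeLieToAssoc]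

theorem freeSubst_onV_single (f : X₁ → FreeLieAlgebra k Y₁) (g : X₂ → FreeVec k Y₁ Y₂) (y : X₂) :
    (freeSubst f g).onV (Finsupp.single y 1 : FreeVec k X₁ X₂) = g y := by
  refine (vecSubst_single f g y 1).trans ?_
  rw [map_one, one_smul]

theorem freeLie_of_ne_zero (x : X₁) : FreeLieAlgebra.of k x ≠ 0 := fun h =>
  FreeAlgebra.ι_ne_zero (R := k) x (by rw [← freeLieToAssoc_of, h, map_zero])

theorem freeLie_lie_ne_zero {x y : X₁} (hxy : x ≠ y) :
    ⁅FreeLieAlgebra.of k x, FreeLieAlgebra.of k y⁆ ≠ 0 := by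
  classical
  intro h
  -- The matrix units `e₀₀` and `e₀₁` have commutator `e₀₁ ≠ 0`.
  have h1 := congrArg (FreeLieAlgebra.lift k fun z : X₁ =>
    if z = x then (Matrix.single 0 0 1 : Matrix (Fin 2) (Fin 2) k) else Matrix.single 0 1 1) h
  rw [LieHom.map_lie, FreeLieAlgebra.lift_of_apply, FreeLieAlgebra.lift_of_apply, if_pos rfl,
    if_neg hxy.symm, map_zero, LieRing.of_associative_ring_bracket] at h1
  have h2 := congrFun (congrFun h1 0) 1
  simp [Matrix.single_mul_single_of_ne] at h2

/-- The identity factors through the abelian Lie algebra `k`, since `j ∘ c` fixes the only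
generator. -/
theorem freeLie_eq_smul_of [Unique X₁] (l : FreeLieAlgebra k X₁) :
    ∃ c : k, l = c • FreeLieAlgebra.of k default := by
  let c : FreeLieAlgebra k X₁ →ₗ⁅k⁆ k := FreeLieAlgebra.lift k fun _ => 1
  let j : k →ₗ⁅k⁆ FreeLieAlgebra k X₁ :=
    { LinearMap.toSpanSingleton k (FreeLieAlgebra k X₁) (FreeLieAlgebra.of k default) with
      map_lie' := fun {a b} => by
        simp [LieRing.of_associative_ring_bracket, mul_comm] }
  have h : (LieHom.id : FreeLieAlgebra k X₁ →ₗ⁅k⁆ _) = j.comp c :=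
    FreeLieAlgebra.hom_ext fun x => by
      obtain rfl := Unique.eq_default x
      simp only [LieHom.comp_apply, c, FreeLieAlgebra.lift_of_apply]
      exact (one_smul k _).symm
  exact ⟨c l, congrArg (fun φ : FreeLieAlgebra k X₁ →ₗ⁅k⁆ _ => φ l) h⟩

theorem freeLie_eq_zero [IsEmpty X₁] (l : FreeLieAlgebra k X₁) : l = 0 := by
  have h : (LieHom.id : FreeLieAlgebra k X₁ →ₗ⁅k⁆ _) = 0 := FreeLieAlgebra.hom_ext isEmptyElim
  exact congrArg (fun φ : FreeLieAlgebra k X₁ →ₗ⁅k⁆ _ => φ l) h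

theorem freeAlgebra_eq_algebraMap [IsEmpty X₁] (a : FreeAlgebra k X₁) :
    ∃ c : k, a = algebraMap k _ c := by
  have h : AlgHom.id k (FreeAlgebra k X₁) = (Algebra.ofId k _).comp FreeAlgebra.algebraMapInv :=
    FreeAlgebra.hom_ext (funext isEmptyElim)
  exact ⟨_, congrArg (fun φ : FreeAlgebra k X₁ →ₐ[k] _ => φ a) h⟩

end FreeRepresentation

/-! ### Passage to relatively free representations. -/

section RelativelyFree

variable {k : Type u} [Field k] {Θ : Set (LieRepr k)} {X₁ X₂ Y₁ Y₂ : Type}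

theorem map_mem_identIdeal (μ : freeRepr k X₁ X₂ ⟶ freeRepr k Y₁ Y₂) {l : FreeLieAlgebra k X₁}
    (hl : l ∈ identIdeal X₁ Θ) : μ.onL l ∈ identIdeal Y₁ Θ :=
  fun H hH φ => hl H hH (φ.comp μ.onL)

theorem map_mem_identSubmodule (μ : freeRepr k X₁ X₂ ⟶ freeRepr k Y₁ Y₂) {v : FreeVec k X₁ X₂}
    (hv : v ∈ identSubmodule X₁ X₂ Θ) : μ.onV v ∈ identSubmodule Y₁ Y₂ Θ :=
  fun H hH ν => hv H hH (μ ≫ ν)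

variable (Θ X₁ X₂) in
/-- The natural projection `F(X) → F_Θ(X)`. -/
noncomputable def relProj : freeRepr k X₁ X₂ ⟶ relFreeRepr X₁ X₂ Θ where
  onL := { LieSubmodule.Quotient.mk' (identIdeal X₁ Θ) with map_lie' := rfl }
  onV := LieSubmodule.Quotient.mk' (identSubmodule X₁ X₂ Θ)
  map_act _ _ := rfl

theorem relProj_onL_surjective : Function.Surjective (relProj Θ X₁ X₂).onL :=
  LieSubmodule.Quotient.surjective_mk' _

theorem relProj_onV_surjective : Function.Surjective (relProj Θ X₁ X₂).onV :=
  LieSubmodule.Quotient.surjective_mk' _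

theorem relProj_onL_eq_zero {l : FreeLieAlgebra k X₁} :
    (relProj Θ X₁ X₂).onL l = 0 ↔ l ∈ identIdeal X₁ Θ :=
  LieSubmodule.Quotient.mk_eq_zero'

theorem relProj_onV_eq_zero {v : FreeVec k X₁ X₂} :
    (relProj Θ X₁ X₂).onV v = 0 ↔ v ∈ identSubmodule X₁ X₂ Θ :=
  LieSubmodule.Quotient.mk_eq_zero'

/-- A homomorphism of absolutely free representations descends to relatively free ones. -/
noncomputable def relMap (μ : freeRepr k X₁ X₂ ⟶ freeRepr k Y₁ Y₂) :
    relFreeRepr X₁ X₂ Θ ⟶ relFreeRepr Y₁ Y₂ Θ where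
  onL :=
    { Submodule.mapQ (identIdeal X₁ Θ).toSubmodule (identIdeal Y₁ Θ).toSubmodule
        (μ.onL : FreeLieAlgebra k X₁ →ₗ[k] FreeLieAlgebra k Y₁)
        (fun _ hl => map_mem_identIdeal μ hl) with
      map_lie' := by
        intro a b
        obtain ⟨a, rfl⟩ := LieSubmodule.Quotient.surjective_mk' _ a
        obtain ⟨b, rfl⟩ := LieSubmodule.Quotient.surjective_mk' _ b
        exact congrArg (LieSubmodule.Quotient.mk' (identIdeal Y₁ Θ)) (LieHom.map_lie μ.onL a b) }
  onV := Submodule.mapQ (identSubmodule X₁ X₂ Θ).toSubmodule (identSubmodule Y₁ Y₂ Θ).toSubmodule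
    μ.onV (fun _ hv => map_mem_identSubmodule μ hv)
  map_act l v := by
    obtain ⟨l, rfl⟩ := LieSubmodule.Quotient.surjective_mk' _ l
    obtain ⟨v, rfl⟩ := LieSubmodule.Quotient.surjective_mk' _ v
    exact congrArg (LieSubmodule.Quotient.mk' (identSubmodule Y₁ Y₂ Θ)) (μ.map_act l v)

/-- Renaming every variable of sort 2 to `0` and killing sort 1 turns such an identity into the one
excluded by nontriviality. -/
theorem single_notMem_identSubmodule (hnt : IsNontrivialVariety Θ) (y : X₂) :
    (Finsupp.single y 1 : FreeVec k X₁ X₂) ∉ identSubmodule X₁ X₂ Θ := fun h =>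
  hnt fun H hH => by
    have h1 := map_mem_identSubmodule
      (freeSubst 0 fun _ => Finsupp.single 0 1 : freeRepr k X₁ X₂ ⟶ freeRepr k ℕ ℕ) h
    rw [freeSubst_onV_single] at h1
    exact h1 H hH

end RelativelyFree

/-! ### Free generators and the universal property in `Θ⁰`. -/

namespace FreeCat

variable {k : Type u} [Field k] {Θ : Set (LieRepr k)}

noncomputable instance : Limits.HasZeroMorphisms (FreeCat Θ) where
  zero _ _ := ⟨InducedCategory.homMk 0⟩
  comp_zero _ _ := InducedCategory.hom_ext Limits.comp_zero
  zero_comp _ _ _ _ := InducedCategory.hom_ext Limits.zero_comp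

section

variable {X Y Z : FreeCat Θ}

theorem id_onL (l : (relFreeRepr ↥X.1 ↥X.2 Θ).L) : (𝟙 X : X ⟶ X).hom.onL l = l := rfl

theorem id_onV (v : (relFreeRepr ↥X.1 ↥X.2 Θ).V) : (𝟙 X : X ⟶ X).hom.onV v = v := rfl

theorem zero_onL (l : (relFreeRepr ↥X.1 ↥X.2 Θ).L) : (0 : X ⟶ Y).hom.onL l = 0 := rfl

theorem zero_onV (v : (relFreeRepr ↥X.1 ↥X.2 Θ).V) : (0 : X ⟶ Y).hom.onV v = 0 := rfl

theorem comp_onL (f : X ⟶ Y) (g : Y ⟶ Z) (l : (relFreeRepr ↥X.1 ↥X.2 Θ).L) :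
    (f ≫ g).hom.onL l = g.hom.onL (f.hom.onL l) := rfl

theorem comp_onV (f : X ⟶ Y) (g : Y ⟶ Z) (v : (relFreeRepr ↥X.1 ↥X.2 Θ).V) :
    (f ≫ g).hom.onV v = g.hom.onV (f.hom.onV v) := rfl

end

/-- The free generator of `F_Θ(X)` given by a variable of the first sort. -/
noncomputable def genL (X : FreeCat Θ) (x : ↥X.1) : (relFreeRepr ↥X.1 ↥X.2 Θ).L :=
  (relProj Θ _ _).onL (FreeLieAlgebra.of k x)

/-- The free generator of `F_Θ(X)` given by a variable of the second sort. -/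
noncomputable def genV (X : FreeCat Θ) (y : ↥X.2) : (relFreeRepr ↥X.1 ↥X.2 Θ).V :=
  (relProj Θ _ _).onV (Finsupp.single y 1 : FreeVec k ↥X.1 ↥X.2)

theorem genL_ne_zero (hact : IsActionType Θ) (X : FreeCat Θ) (x : ↥X.1) : genL X x ≠ 0 := by
  intro h
  have h1 := relProj_onL_eq_zero.1 h
  rw [hact X.1] at h1
  exact freeLie_of_ne_zero x ((LieSubmodule.mem_bot _).1 h1)

theorem genL_lie_ne_zero (hact : IsActionType Θ) (X : FreeCat Θ) {x y : ↥X.1} (hxy : x ≠ y) :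
    ⁅genL X x, genL X y⁆ ≠ 0 := by
  intro h
  have h1 := relProj_onL_eq_zero.1 ((LieHom.map_lie (relProj Θ X.1 X.2).onL _ _).trans h)
  rw [hact X.1] at h1
  exact freeLie_lie_ne_zero hxy ((LieSubmodule.mem_bot _).1 h1)

theorem genV_ne_zero (hnt : IsNontrivialVariety Θ) (X : FreeCat Θ) (y : ↥X.2) : genV X y ≠ 0 :=
  fun h => single_notMem_identSubmodule hnt y (relProj_onV_eq_zero.1 h)

theorem hom_ext {X Y : FreeCat Θ} {f g : X ⟶ Y}
    (hL : ∀ x, f.hom.onL (genL X x) = g.hom.onL (genL X x))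
    (hV : ∀ y, f.hom.onV (genV X y) = g.hom.onV (genV X y)) : f = g := by
  have h : relProj Θ _ _ ≫ f.hom = relProj Θ _ _ ≫ g.hom := freeRepr_hom_ext hL hV
  refine InducedCategory.hom_ext (LieRepr.Hom.ext (LieHom.ext fun l => ?_)
    (LinearMap.ext fun v => ?_))
  · obtain ⟨l, rfl⟩ := relProj_onL_surjective l
    exact congrArg (fun φ : freeRepr k ↥X.1 ↥X.2 ⟶ _ => φ.onL l) h
  · obtain ⟨v, rfl⟩ := relProj_onV_surjective v
    exact congrArg (fun φ : freeRepr k ↥X.1 ↥X.2 ⟶ _ => φ.onV v) h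

/-- The prescribed images are lifted to the absolutely free representation; the resulting
substitution descends because substitutions preserve identities. -/
theorem exists_hom (X Y : FreeCat Θ) (f : ↥X.1 → (relFreeRepr ↥Y.1 ↥Y.2 Θ).L)
    (g : ↥X.2 → (relFreeRepr ↥Y.1 ↥Y.2 Θ).V) :
    ∃ φ : X ⟶ Y, (∀ x, φ.hom.onL (genL X x) = f x) ∧ ∀ y, φ.hom.onV (genV X y) = g y := by
  choose f' hf using fun x => relProj_onL_surjective (X₂ := ↥Y.2) (f x)
  choose g' hg using fun y => relProj_onV_surjective (g y)
  refine ⟨InducedCategory.homMk (relMap (freeSubst f' g')), fun x => ?_, fun y => ?_⟩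
  · rw [← hf]
    exact congrArg (relProj Θ ↥Y.1 ↥Y.2).onL (FreeLieAlgebra.lift_of_apply _ _)
  · rw [← hg]
    exact congrArg (relProj Θ ↥Y.1 ↥Y.2).onV (freeSubst_onV_single _ _ _)

theorem exists_eq_smul_genL (X : FreeCat Θ) [Unique ↥X.1] (l : (relFreeRepr ↥X.1 ↥X.2 Θ).L) :
    ∃ c : k, l = c • genL X default := by
  obtain ⟨l, rfl⟩ := relProj_onL_surjective (X₂ := ↥X.2) l
  obtain ⟨c, rfl⟩ := freeLie_eq_smul_of l
  exact ⟨c, map_smul (relProj Θ ↥X.1 ↥X.2).onL _ _⟩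

theorem onL_eq_zero (X : FreeCat Θ) [IsEmpty ↥X.1] (l : (relFreeRepr ↥X.1 ↥X.2 Θ).L) : l = 0 := by
  obtain ⟨l, rfl⟩ := relProj_onL_surjective (X₂ := ↥X.2) l
  rw [freeLie_eq_zero l, map_zero]

/-- Without variables of sort 1 the algebra `A(X₁)` is just `k`. -/
theorem exists_eq_sum_genV (X : FreeCat Θ) [IsEmpty ↥X.1] (v : (relFreeRepr ↥X.1 ↥X.2 Θ).V) :
    ∃ c : ↥X.2 → k, v = ∑ y, c y • genV X y := by
  obtain ⟨v, rfl⟩ := relProj_onV_surjective v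
  choose c hc using fun y => freeAlgebra_eq_algebraMap (v y)
  refine ⟨c, ?_⟩
  have h : v = ∑ y, c y • (Finsupp.single y 1 : FreeVec k ↥X.1 ↥X.2) := by
    conv_lhs => rw [← Finsupp.univ_sum_single v]
    refine Finset.sum_congr rfl fun y _ => ?_
    rw [hc, Finsupp.smul_single, Algebra.algebraMap_eq_smul_one]
  refine (congrArg (relProj Θ ↥X.1 ↥X.2).onV h).trans
    ((map_sum (relProj Θ ↥X.1 ↥X.2).onV _ _).trans ?_)
  exact Finset.sum_congr rfl fun y _ => map_smul (relProj Θ ↥X.1 ↥X.2).onV _ _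

end FreeCat

/-! ### Properties invariant under equivalences. -/

section Categorical

open Limits

variable {C D : Type*} [Category* C] [Category* D] [HasZeroMorphisms C] [HasZeroMorphisms D]

/-- `X` is nonzero and its only idempotent endomorphisms are zero and the identity. -/
def HasTrivialIdempotents (X : C) : Prop :=
  𝟙 X ≠ 0 ∧ ∀ e : X ⟶ X, e ≫ e = e → e = 0 ∨ e = 𝟙 X

/-- There are an object `T` without nonzero morphisms to `B` and a nonzero morphism `A ⟶ T` which
is killed by all morphisms `T ⟶ A`. -/
def HasInvisibleMorphism (A B : C) : Prop :=
  ∃ (T : C) (f : A ⟶ T), f ≠ 0 ∧ (∀ g : T ⟶ A, f ≫ g = 0) ∧ ∀ h : T ⟶ B, h = 0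

theorem HasTrivialIdempotents.map (E : C ≌ D) {X : C} (h : HasTrivialIdempotents X) :
    HasTrivialIdempotents (E.functor.obj X) := by
  refine ⟨fun h0 => h.1 (E.functor.map_injective ?_), fun e he => ?_⟩
  · rw [E.functor.map_id, h0, E.functor.map_zero]
  · obtain ⟨e, rfl⟩ := E.functor.map_surjective e
    rw [← E.functor.map_comp] at he
    rcases h.2 e (E.functor.map_injective he) with rfl | rfl
    · exact Or.inl (E.functor.map_zero _ _)
    · exact Or.inr (E.functor.map_id _)

theorem HasInvisibleMorphism.map (E : C ≌ D) {A B : C} (h : HasInvisibleMorphism A B) :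
    HasInvisibleMorphism (E.functor.obj A) (E.functor.obj B) := by
  obtain ⟨T, f, hf, hg, hB⟩ := h
  refine ⟨E.functor.obj T, E.functor.map f, fun h0 => hf (E.functor.map_injective ?_),
    fun g => ?_, fun g => ?_⟩
  · rw [h0, E.functor.map_zero]
  · obtain ⟨g, rfl⟩ := E.functor.map_surjective g
    rw [← E.functor.map_comp, hg, E.functor.map_zero]
  · obtain ⟨g, rfl⟩ := E.functor.map_surjective g
    rw [hB g, E.functor.map_zero]

theorem HasInvisibleMorphism.of_iso {A B A' B' : C} (i : A ≅ A') (j : B ≅ B')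
    (h : HasInvisibleMorphism A B) : HasInvisibleMorphism A' B' := by
  obtain ⟨T, f, hf, hg, hB⟩ := h
  refine ⟨T, i.inv ≫ f, fun h0 => hf ?_, fun g => ?_, fun g => ?_⟩
  · rw [← cancel_epi i.inv, h0, comp_zero]
  · rw [← cancel_mono i.inv, Category.assoc, Category.assoc, hg, comp_zero, zero_comp]
  · rw [← cancel_mono j.inv, hB (g ≫ j.inv), zero_comp]

end Categorical

/-! ### Recognising the one-generated objects. -/

namespace FreeCat

variable {k : Type u} [Field k] {Θ : Set (LieRepr k)}

theorem freeOnL_isEmpty (x : ℕ) : IsEmpty ↥(freeOnL Θ x).2 := Finset.isEmpty_coe_sort.2 rfl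

theorem freeOnV_isEmpty (x : ℕ) : IsEmpty ↥(freeOnV Θ x).1 := Finset.isEmpty_coe_sort.2 rfl

noncomputable instance freeOnL_unique (x : ℕ) : Unique ↥(freeOnL Θ x).1 :=
  inferInstanceAs (Unique ↥({x} : Finset ℕ))

noncomputable instance freeOnV_unique (x : ℕ) : Unique ↥(freeOnV Θ x).2 :=
  inferInstanceAs (Unique ↥({x} : Finset ℕ))

attribute [local instance] freeOnL_isEmpty freeOnV_isEmpty

theorem nonempty_iso_of_unique_L (X Y : FreeCat Θ) [Unique ↥X.1] [Unique ↥Y.1] [IsEmpty ↥X.2]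
    [IsEmpty ↥Y.2] : Nonempty (X ≅ Y) := by
  obtain ⟨f, hf, -⟩ := exists_hom X Y (fun _ => genL Y default) isEmptyElim
  obtain ⟨g, hg, -⟩ := exists_hom Y X (fun _ => genL X default) isEmptyElim
  refine ⟨⟨f, g, hom_ext (fun x => ?_) isEmptyElim, hom_ext (fun x => ?_) isEmptyElim⟩⟩
  · obtain rfl := Unique.eq_default x
    rw [comp_onL, hf, hg, id_onL]
  · obtain rfl := Unique.eq_default x
    rw [comp_onL, hg, hf, id_onL]

theorem nonempty_iso_of_unique_V (X Y : FreeCat Θ) [Unique ↥X.2] [Unique ↥Y.2] [IsEmpty ↥X.1]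
    [IsEmpty ↥Y.1] : Nonempty (X ≅ Y) := by
  obtain ⟨f, -, hf⟩ := exists_hom X Y isEmptyElim (fun _ => genV Y default)
  obtain ⟨g, -, hg⟩ := exists_hom Y X isEmptyElim (fun _ => genV X default)
  refine ⟨⟨f, g, hom_ext isEmptyElim (fun x => ?_), hom_ext isEmptyElim (fun x => ?_)⟩⟩
  · obtain rfl := Unique.eq_default x
    rw [comp_onV, hf, hg, id_onV]
  · obtain rfl := Unique.eq_default x
    rw [comp_onV, hg, hf, id_onV]

theorem hasTrivialIdempotents_freeOnL (hact : IsActionType Θ) (x : ℕ) :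
    HasTrivialIdempotents (freeOnL Θ x) := by
  refine ⟨fun h => genL_ne_zero hact (freeOnL Θ x) default ?_, fun e he => ?_⟩
  · exact congrArg (fun e : freeOnL Θ x ⟶ freeOnL Θ x => e.hom.onL (genL _ default)) h
  · obtain ⟨c, hc⟩ := exists_eq_smul_genL (freeOnL Θ x) (e.hom.onL (genL _ default))
    have h2 : (c * c) • genL (freeOnL Θ x) default = c • genL (freeOnL Θ x) default := by
      rw [← hc, mul_smul, ← hc, ← map_smul, ← hc, ← comp_onL, he]
    have h3 := smul_left_injective k (genL_ne_zero hact (freeOnL Θ x) default) h2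
    -- The endomorphism multiplies the generator by `c`, and `c * c = c` in a field.
    rcases IsIdempotentElem.iff_eq_zero_or_one.1 h3 with rfl | rfl
    · refine Or.inl (hom_ext (fun y => ?_) isEmptyElim)
      obtain rfl := Unique.eq_default y
      rw [hc, zero_smul, zero_onL]
    · refine Or.inr (hom_ext (fun y => ?_) isEmptyElim)
      obtain rfl := Unique.eq_default y
      rw [hc, one_smul, id_onL]

theorem exists_eq_smul_genV (X : FreeCat Θ) [IsEmpty ↥X.1] [Unique ↥X.2]
    (v : (relFreeRepr ↥X.1 ↥X.2 Θ).V) : ∃ c : k, v = c • genV X default := by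
  obtain ⟨c, rfl⟩ := exists_eq_sum_genV X v
  exact ⟨c default, by rw [Fintype.sum_unique]⟩

theorem hasTrivialIdempotents_freeOnV (hnt : IsNontrivialVariety Θ) (x : ℕ) :
    HasTrivialIdempotents (freeOnV Θ x) := by
  refine ⟨fun h => genV_ne_zero hnt (freeOnV Θ x) default ?_, fun e he => ?_⟩
  · exact congrArg (fun e : freeOnV Θ x ⟶ freeOnV Θ x => e.hom.onV (genV _ default)) h
  · obtain ⟨c, hc⟩ := exists_eq_smul_genV (freeOnV Θ x) (e.hom.onV (genV _ default))
    have h2 : (c * c) • genV (freeOnV Θ x) default = c • genV (freeOnV Θ x) default := by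
      rw [← hc, mul_smul, ← hc, ← map_smul, ← hc, ← comp_onV, he]
    have h3 := smul_left_injective k (genV_ne_zero hnt (freeOnV Θ x) default) h2
    rcases IsIdempotentElem.iff_eq_zero_or_one.1 h3 with rfl | rfl
    · refine Or.inl (hom_ext isEmptyElim (fun y => ?_))
      obtain rfl := Unique.eq_default y
      rw [hc, zero_smul, zero_onV]
    · refine Or.inr (hom_ext isEmptyElim (fun y => ?_))
      obtain rfl := Unique.eq_default y
      rw [hc, one_smul, id_onV]

theorem hom_freeOnV_eq_zero (X : FreeCat Θ) [IsEmpty ↥X.2] (x : ℕ)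
    (f : X ⟶ freeOnV Θ x) : f = 0 :=
  hom_ext (fun _ => onL_eq_zero _ _) isEmptyElim

theorem isEmpty_iso (hact : IsActionType Θ) (x y : ℕ) : IsEmpty (freeOnL Θ x ≅ freeOnV Θ y) :=
  ⟨fun i => (hasTrivialIdempotents_freeOnL hact x).1 (by
    rw [← i.hom_inv_id, hom_freeOnV_eq_zero _ _ i.hom, Limits.zero_comp])⟩

theorem iso_of_hasTrivialIdempotents (hact : IsActionType Θ) (hnt : IsNontrivialVariety Θ)
    {X : FreeCat Θ} (h : HasTrivialIdempotents X) (x y : ℕ) :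
    Nonempty (X ≅ freeOnL Θ x) ∨ Nonempty (X ≅ freeOnV Θ y) := by
  classical
  rcases isEmpty_or_nonempty ↥X.1 with h1 | ⟨⟨a⟩⟩
  · rcases isEmpty_or_nonempty ↥X.2 with h2 | ⟨⟨a⟩⟩
    · exact absurd (hom_ext isEmptyElim isEmptyElim) h.1
    · obtain ⟨e, -, he⟩ := exists_hom X X isEmptyElim fun y => if y = a then genV X y else 0
      have he2 : e ≫ e = e := hom_ext isEmptyElim fun y => by
        by_cases hy : y = a
        · rw [comp_onV, he, if_pos hy, he, if_pos hy]
        · rw [comp_onV, he, if_neg hy, map_zero]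
      rcases h.2 e he2 with rfl | rfl
      · exact absurd (((he a).trans (if_pos rfl)).symm) (genV_ne_zero hnt X a)
      · have : Unique ↥X.2 := ⟨⟨a⟩, fun y => by
          by_contra hy
          exact genV_ne_zero hnt X y ((he y).trans (if_neg hy))⟩
        exact Or.inr (nonempty_iso_of_unique_V X (freeOnV Θ y))
  -- All generators of sort 2 are killed as well, so `e = 𝟙 X` also forces `X.2` to be empty.
  · obtain ⟨e, he, he'⟩ := exists_hom X X (fun x => if x = a then genL X x else 0) 0
    have he2 : e ≫ e = e := hom_ext
      (fun x => by
        by_cases hx : x = a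
        · rw [comp_onL, he, if_pos hx, he, if_pos hx]
        · rw [comp_onL, he, if_neg hx, map_zero])
      (fun y => by rw [comp_onV, he', Pi.zero_apply, map_zero])
    rcases h.2 e he2 with rfl | rfl
    · exact absurd (((he a).trans (if_pos rfl)).symm) (genL_ne_zero hact X a)
    · have : Unique ↥X.1 := ⟨⟨a⟩, fun y => by
        by_contra hy
        exact genL_ne_zero hact X y ((he y).trans (if_neg hy))⟩
      have : IsEmpty ↥X.2 := ⟨fun y => genV_ne_zero hnt X y (he' y)⟩
      exact Or.inl (nonempty_iso_of_unique_L X (freeOnL Θ x))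

theorem hasInvisibleMorphism_freeOnL (hact : IsActionType Θ) (x y : ℕ) :
    HasInvisibleMorphism (freeOnL Θ x) (freeOnV Θ y) := by
  let T : FreeCat Θ := (({0, 1}, ∅) : Finset ℕ × Finset ℕ)
  have : IsEmpty ↥T.2 := Finset.isEmpty_coe_sort.2 rfl
  let a : ↥T.1 := ⟨0, by simp [T]⟩
  let b : ↥T.1 := ⟨1, by simp [T]⟩
  have hab : a ≠ b := fun h => zero_ne_one (congrArg Subtype.val h)
  obtain ⟨f, hf, -⟩ := exists_hom (freeOnL Θ x) T (fun _ => ⁅genL T a, genL T b⁆) isEmptyElim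
  refine ⟨T, f, ?_, fun g => hom_ext (fun z => ?_) isEmptyElim,
    hom_freeOnV_eq_zero T y⟩
  · rintro rfl
    exact genL_lie_ne_zero hact T hab (hf default).symm
  -- Both generators go to multiples of one element, so their commutator goes to zero.
  · obtain ⟨c, hc⟩ := exists_eq_smul_genL (freeOnL Θ x) (g.hom.onL (genL T a))
    obtain ⟨d, hd⟩ := exists_eq_smul_genL (freeOnL Θ x) (g.hom.onL (genL T b))
    rw [comp_onL, hf, LieHom.map_lie, hc, hd, smul_lie, lie_smul, lie_self, smul_zero, smul_zero,
      zero_onL]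

theorem not_hasInvisibleMorphism_freeOnV (hact : IsActionType Θ) (hnt : IsNontrivialVariety Θ)
    (x y : ℕ) : ¬ HasInvisibleMorphism (freeOnV Θ x) (freeOnL Θ y) := by
  classical
  rintro ⟨T, f, hf, hg, hT⟩
  -- A generator of sort 1 in `T` could be sent to the generator of `freeOnL Θ y`, giving a nonzero
  -- morphism.
  have : IsEmpty ↥T.1 := ⟨fun a => by
    obtain ⟨h, hh, -⟩ := exists_hom T (freeOnL Θ y) (fun _ => genL _ default) 0
    rw [hT h] at hh
    exact genL_ne_zero hact (freeOnL Θ y) default (hh a).symm⟩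
  obtain ⟨c, hc⟩ := exists_eq_sum_genV T (f.hom.onV (genV _ default))
  refine hf (hom_ext isEmptyElim fun z => ?_)
  obtain rfl := Unique.eq_default z
  have hc0 : ∀ b, c b = 0 := fun b => by
    -- The coordinate projection at `b` maps the image of the generator under `f` to `c b` times the
    -- generator.
    obtain ⟨g, -, h⟩ := exists_hom T (freeOnV Θ x) isEmptyElim
      fun z => if z = b then genV _ default else 0
    have h2 : c b • genV (freeOnV Θ x) default = 0 := by
      rw [← zero_onV (X := freeOnV Θ x) (genV _ default), ← hg g, comp_onV, hc, map_sum]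
      simp_rw [map_smul, h, smul_ite, smul_zero]
      rw [Finset.sum_ite_eq' _ b, if_pos (Finset.mem_univ b)]
    exact (smul_eq_zero.1 h2).resolve_right (genV_ne_zero hnt _ _)
  rw [hc, zero_onV]
  exact Finset.sum_eq_zero fun b _ => by rw [hc0, zero_smul]

theorem equivalence_preserves_generators (hact : IsActionType Θ) (hnt : IsNontrivialVariety Θ)
    (E : FreeCat Θ ≌ FreeCat Θ) (x y : ℕ) :
    Nonempty (E.functor.obj (freeOnL Θ x) ≅ freeOnL Θ x) ∧
      Nonempty (E.functor.obj (freeOnV Θ y) ≅ freeOnV Θ y) := by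
  have hne : IsEmpty (E.functor.obj (freeOnL Θ x) ≅ E.functor.obj (freeOnV Θ y)) :=
    ⟨fun i => (isEmpty_iso hact x y).false (E.functor.preimageIso i)⟩
  have hL := iso_of_hasTrivialIdempotents hact hnt
    ((hasTrivialIdempotents_freeOnL hact x).map E) x y
  have hV := iso_of_hasTrivialIdempotents hact hnt
    ((hasTrivialIdempotents_freeOnV hnt y).map E) x y
  rcases hL with ⟨⟨i⟩⟩ | ⟨⟨i⟩⟩ <;> rcases hV with ⟨⟨j⟩⟩ | ⟨⟨j⟩⟩
  · exact (hne.false (i ≪≫ j.symm)).elim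
  · exact ⟨⟨i⟩, ⟨j⟩⟩
  -- The swap: the invisible morphism would be transported to the reversed pair.
  · exact (not_hasInvisibleMorphism_freeOnV hact hnt y x
      (((hasInvisibleMorphism_freeOnL hact x y).map E).of_iso i j)).elim
  · exact (hne.false (i ≪≫ j.symm)).elim

end FreeCat

theorem mainTheorem5 {k : Type u} [Field k] [CharZero k] (Θ : Set (LieRepr k))
    (hΘ : IsVariety Θ) (hact : IsActionType Θ) (hnt : IsNontrivialVariety Θ)
    (Φ : Aut (Cat.of (FreeCat Θ))) :
    (∀ x : ℕ, Nonempty (Φ.hom.toFunctor.obj (freeOnL Θ x) ≅ freeOnL Θ x)) ∧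
    (∀ x : ℕ, Nonempty (Φ.hom.toFunctor.obj (freeOnV Θ x) ≅ freeOnV Θ x)) ∧
    (∀ x y : ℕ, IsEmpty (Φ.hom.toFunctor.obj (freeOnL Θ x) ≅ freeOnV Θ y) ∧
      IsEmpty (Φ.hom.toFunctor.obj (freeOnV Θ y) ≅ freeOnL Θ x)) := by
  have h := FreeCat.equivalence_preserves_generators hact hnt (Cat.equivOfIso Φ)
  refine ⟨fun x => (h x x).1, fun x => (h x x).2, fun x y => ⟨⟨fun i => ?_⟩, ⟨fun i => ?_⟩⟩⟩
  · obtain ⟨j⟩ := (h x y).1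
    exact (FreeCat.isEmpty_iso hact x y).false (j.symm ≪≫ i)
  · obtain ⟨j⟩ := (h x y).2
    exact (FreeCat.isEmpty_iso hact x y).false (i.symm ≪≫ j)
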